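/- Let $K$ be an algebraically closed field of characteristic zero and $A\subset\mathbb Z^d$ a finite set with $\mathbb ZA=\mathbb Z^d$ whose cone $C=\mathbb R_{\ge0}A$ is strongly convex. Let $\mathcal F$ be the set of facets (faces of codimension one) of $C$, and for $\sigma\in\mathcal F$ let $F_\sigma$ be its primitive integral support function, i.e. the linear form on $\mathbb R^d$ with $F_\sigma\ge0$ on $C$, $F_\sigma=0$ on $\sigma$ and $F_\sigma(\mathbb Z^d)=\mathbb Z$. A set $S\subseteq\mathbb Z^d$ is an $\mathbb NA$-set if $S+\mathbb NA\subseteq S$, and it is scored if $S=\bigcap_{\sigma\in\mathcal F}\{a\in\mathbb Z^d: F_\sigma(a)\in F_\sigma(S)\}$. Let $S_c$ be a finitely generated scored $\mathbb NA$-set, $b_1,\dots,b_m\in S_c$, and $\tau_1,\dots,\tau_m$ faces of $C$, and let $$S=S_c\setminus\bigcup_{i=1}^m\bigl(b_i+\mathbb Z(A\cap\tau_i)\bigr),$$ where the expression is irredundant (no term of the union can be omitted), $F_\sigma(S)=F_\sigma(S_c)$ for all $\sigma\in\mathcal F$, and $S$ is an $\mathbb NA$-set. Put $\tilde{\mathcal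 F}=\mathcal F\cup\{\tau_1,\dots,\tau_m\}$, and for a face $\tau$ let $K\tau\subseteq K^d$ be the $K$-span of $A\cap\tau$. Let $\mathcal B$ be the set of families $(b_\tau)_{\tau\in\tilde{\mathcal F}}$ with $b_\tau\in(K\tau\cap\mathbb Z^d)/\mathbb Z(A\cap\tau)$ such that for all $i$ and all $\tau\in\tilde{\mathcal F}$ with $\tau\supseteq\tau_i$ there is $j$ with $\tau_j=\tau$ and $b_i+b_{\tau_i}\equiv b_j+b_{\tau_j}\pmod{\mathbb Z(A\cap\tau)}$. Assume $\mathcal B\ne\emptyset$, fix $(b_\tau)\in\mathcal B$, and set $$\omega(S)=\{a\in\mathbb Z^d:\ -a-b_\tau\notin S+\mathbb Z(A\cap\tau)\ \text{for all }\tau\in\tilde{\mathcal F}\}.$$ For $T\subseteq\mathbb Z^d$ let $K[T]=\bigoplus_{a\in T}Kt^a\subseteq K[\mathbb Z^d]=K[t_1^{\pm1},\dots,t_d^{\pm1}]$ and $D(T)=\{P\in D(\mathbb Z^d):P(K[T])\subseteq K[T]\}$, where $D(\mathbb Z^d)=K[t_1^{\pm1},\dots,t_d^{\pm1}]\langle\partial_1,\dots,\partial_d\rangle$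 is the ring of differential operators with Laurent polynomial coefficients, acting on $K[\mathbb Z^d]$. Theorem. If $\omega(S)=a+S$ for some $a\in\mathbb Z^d$, then $D(a+S)=t^aD(S)t^{-a}$, and there are one-to-one correspondences between the left modules and the right modules of $D(S)$ (an equivalence of categories that preserves underlying $K$-vector spaces) and between the left ideals and the right ideals of $D(S)$ (an inclusion-preserving bijection). -/

import Mathlib

universe u v

open CategoryTheory

noncomputable section

namespace ToricDiffOp

/-! ### The cone of `A`, its faces and facets -/

section Cone

variable {d : ℕ}

/-- An integer vector regarded as a real vector. -/
def toReal (z : Fin d → ℤ) : Fin d → ℝ := fun i => (z i : ℝ)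

/-- The monoid `ℕA` generated by `A`. -/
def monoidOf (A : Finset (Fin d → ℤ)) : AddSubmonoid (Fin d → ℤ) :=
  AddSubmonoid.closure (A : Set (Fin d → ℤ))

/-- The cone `ℝ_{≥ 0} A` generated by `A`. -/
def coneOf (A : Finset (Fin d → ℤ)) : PointedCone ℝ (Fin d → ℝ) :=
  PointedCone.hull ℝ (toReal '' (A : Set (Fin d → ℤ)))

/-- The facets of `ℝ_{≥ 0} A`: its faces of codimension one (the cone is full-dimensional,
because `ℤA = ℤ^d` is assumed below). -/
def IsFacet (A : Finset (Fin d → ℤ)) (σ : PointedCone ℝ (Fin d → ℝ)) : Prop :=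
  σ.IsFaceOf (coneOf A) ∧
    Module.finrank ℝ (Submodule.span ℝ (σ : Set (Fin d → ℝ))) + 1 = d

/-- `F` is the primitive integral support function `F_σ` of the facet `σ`: a linear form that is
nonnegative on the cone, vanishes on `σ`, and satisfies `F(ℤ^d) = ℤ`. These properties determine
`F` uniquely. -/
structure IsSupportFunction (A : Finset (Fin d → ℤ)) (σ : PointedCone ℝ (Fin d → ℝ))
    (F : (Fin d → ℝ) →ₗ[ℝ] ℝ) : Prop where
  nonneg : ∀ x ∈ coneOf A, 0 ≤ F x
  eq_zero : ∀ x ∈ σ, F x = 0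
  range_int : Set.range (fun z : Fin d → ℤ => F (toReal z)) = Set.range (fun n : ℤ => (n : ℝ))

/-- The set of values `F(S)`. -/
def values (F : (Fin d → ℝ) →ₗ[ℝ] ℝ) (S : Set (Fin d → ℤ)) : Set ℝ :=
  (fun z => F (toReal z)) '' S

/-- The group `ℤ(A ∩ τ)`. -/
def faceLattice (A : Finset (Fin d → ℤ)) (τ : PointedCone ℝ (Fin d → ℝ)) :
    AddSubgroup (Fin d → ℤ) :=
  AddSubgroup.closure {a | a ∈ A ∧ toReal a ∈ τ}

/-- The lattice points `Kτ ∩ ℤ^d`, where `Kτ ⊆ K^d` is the `K`-span of `A ∩ τ`. -/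
def spanLattice (K : Type*) [Field K] (A : Finset (Fin d → ℤ))
    (τ : PointedCone ℝ (Fin d → ℝ)) : Set (Fin d → ℤ) :=
  {z | (fun i => (z i : K)) ∈ Submodule.span K
    ((fun (a : Fin d → ℤ) (i : Fin d) => (a i : K)) '' {a | a ∈ A ∧ toReal a ∈ τ})}

/-! ### `ℕA`-sets and standard expressions -/

/-- `S` is an `ℕA`-set: `S + ℕA ⊆ S`. -/
def IsNASet (A : Finset (Fin d → ℤ)) (S : Set (Fin d → ℤ)) : Prop :=
  ∀ s ∈ S, ∀ a ∈ monoidOf A, s + a ∈ S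

/-- `S` is generated by finitely many elements as an `ℕA`-set. -/
def IsFinGen (A : Finset (Fin d → ℤ)) (S : Set (Fin d → ℤ)) : Prop :=
  ∃ G : Finset (Fin d → ℤ), S = {z | ∃ g ∈ G, ∃ a ∈ monoidOf A, z = g + a}

/-- `S` is scored: `S = ⋂_σ {a ∈ ℤ^d : F_σ(a) ∈ F_σ(S)}`, the intersection running over all
facets `σ`. -/
def IsScored (A : Finset (Fin d → ℤ)) (S : Set (Fin d → ℤ)) : Prop :=
  S = {a | ∀ σ F, IsFacet A σ → IsSupportFunction A σ F → F (toReal a) ∈ values F S}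

/-- The set `S + ℤ(A ∩ τ)`. -/
def localization (A : Finset (Fin d → ℤ)) (S : Set (Fin d → ℤ))
    (τ : PointedCone ℝ (Fin d → ℝ)) : Set (Fin d → ℤ) :=
  {z | ∃ s ∈ S, ∃ l ∈ faceLattice A τ, z = s + l}

/-- The coset `b + ℤ(A ∩ τ)`. -/
def faceCoset (A : Finset (Fin d → ℤ)) (b : Fin d → ℤ) (τ : PointedCone ℝ (Fin d → ℝ)) :
    Set (Fin d → ℤ) :=
  {z | ∃ l ∈ faceLattice A τ, z = b + l}

/-- `S = Sc ∖ ⋃ᵢ (bᵢ + ℤ(A ∩ τᵢ))` is the standard expression of `S`, with scored closure `Sc`. -/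
structure IsStandardExpression (A : Finset (Fin d → ℤ)) (S Sc : Set (Fin d → ℤ)) {m : ℕ}
    (b : Fin m → Fin d → ℤ) (τ : Fin m → PointedCone ℝ (Fin d → ℝ)) : Prop where
  isNASet_closure : IsNASet A Sc
  isFinGen_closure : IsFinGen A Sc
  isScored_closure : IsScored A Sc
  mem_closure : ∀ i, b i ∈ Sc
  isFace : ∀ i, (τ i).IsFaceOf (coneOf A)
  eq_diff : S = Sc \ ⋃ i, faceCoset A (b i) (τ i)
  irredundant : ∀ i, S ≠ Sc \ ⋃ j ∈ {j | j ≠ i}, faceCoset A (b j) (τ j)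
  values_eq : ∀ σ F, IsFacet A σ → IsSupportFunction A σ F → values F S = values F Sc

/-! ### The sets `𝓑` and `ω(S)` -/

/-- The set of faces `𝓕 ∪ {τᵢ : i = 1, …, m}`. -/
def extFaces (A : Finset (Fin d → ℤ)) {m : ℕ} (τ : Fin m → PointedCone ℝ (Fin d → ℝ)) :
    Set (PointedCone ℝ (Fin d → ℝ)) :=
  {ρ | IsFacet A ρ ∨ ∃ i, ρ = τ i}

/-- The set `𝓑`. Its elements are families of classes in `(Kρ ∩ ℤ^d) / ℤ(A ∩ ρ)`, indexed by the
faces `ρ` in `extFaces A τ`; they are given here by representatives `β ρ ∈ Kρ ∩ ℤ^d`, and the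
values of `β` at other cones play no role. All conditions depend on the classes only. -/
def familiesB (K : Type*) [Field K] (A : Finset (Fin d → ℤ)) {m : ℕ} (b : Fin m → Fin d → ℤ)
    (τ : Fin m → PointedCone ℝ (Fin d → ℝ)) :
    Set (PointedCone ℝ (Fin d → ℝ) → Fin d → ℤ) :=
  {β | (∀ ρ ∈ extFaces A τ, β ρ ∈ spanLattice K A ρ) ∧
    ∀ i, ∀ ρ ∈ extFaces A τ, τ i ≤ ρ →
      ∃ j, τ j = ρ ∧ (b i + β (τ i)) - (b j + β (τ j)) ∈ faceLattice A ρ}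

/-- The set `ω(S)` attached to an element `β` of `𝓑`. -/
def omega (A : Finset (Fin d → ℤ)) {m : ℕ} (S : Set (Fin d → ℤ))
    (τ : Fin m → PointedCone ℝ (Fin d → ℝ))
    (β : PointedCone ℝ (Fin d → ℝ) → Fin d → ℤ) : Set (Fin d → ℤ) :=
  {a | ∀ ρ ∈ extFaces A τ, -a - β ρ ∉ localization A S ρ}

/-- The translate `a + S`. -/
def translate (a : Fin d → ℤ) (S : Set (Fin d → ℤ)) : Set (Fin d → ℤ) :=
  {z | ∃ s ∈ S, z = a + s}

end Cone

/-! ### Rings of differential operators -/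

section Operators

variable (K : Type*) [Field K] (d : ℕ)

/-- The Laurent polynomial ring `K[ℤ^d] = K[t₁^{±1}, …, t_d^{±1}]`. -/
abbrev Laurent : Type _ := AddMonoidAlgebra K (Fin d → ℤ)

variable {d}

/-- The monomial `t^a`. -/
def monomial (a : Fin d → ℤ) : Laurent K d := AddMonoidAlgebra.single a 1

/-- Multiplication by `t^a` as an operator on `K[ℤ^d]`. -/
def mulMonomial (a : Fin d → ℤ) : Module.End K (Laurent K d) :=
  LinearMap.mulLeft K (monomial K a)

/-- The partial derivative `∂_j`, that is, `t^b ↦ b_j t^{b - e_j}`. -/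
def partialDeriv (j : Fin d) : Module.End K (Laurent K d) :=
  (Finsupp.linearCombination K fun b : Fin d → ℤ =>
      (b j : K) • monomial K (b - Pi.single j 1)) ∘ₗ
    (AddMonoidAlgebra.coeffLinearEquiv K).toLinearMap

theorem partialDeriv_monomial (j : Fin d) (b : Fin d → ℤ) :
    partialDeriv K j (monomial K b) = (b j : K) • monomial K (b - Pi.single j 1) := by
  simp [partialDeriv, monomial]

variable (d)

/-- The ring `D(ℤ^d) = K[t₁^{±1}, …, t_d^{±1}]⟨∂₁, …, ∂_d⟩` of differential operators with Laurent
polynomial coefficients, acting on `K[ℤ^d]`. -/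
def diffOpTorus : Subalgebra K (Module.End K (Laurent K d)) :=
  Algebra.adjoin K (Set.range (mulMonomial K) ∪ Set.range (partialDeriv K))

variable {d}

/-- The subspace `K[S] = ⨁_{a ∈ S} K t^a` of `K[ℤ^d]`. -/
def span (S : Set (Fin d → ℤ)) : Submodule K (Laurent K d) :=
  Submodule.span K (monomial K '' S)

/-- The ring of differential operators `D(S) = {P ∈ D(ℤ^d) : P(K[S]) ⊆ K[S]}`. -/
def diffOp (S : Set (Fin d → ℤ)) : Subalgebra K (Module.End K (Laurent K d)) where
  carrier := {P | P ∈ diffOpTorus K d ∧ ∀ f ∈ span K S, P f ∈ span K S}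
  mul_mem' := fun hP hQ =>
    ⟨mul_mem hP.1 hQ.1, fun f hf => hP.2 _ (hQ.2 f hf)⟩
  add_mem' := fun hP hQ =>
    ⟨add_mem hP.1 hQ.1, fun f hf => add_mem (hP.2 f hf) (hQ.2 f hf)⟩
  algebraMap_mem' := fun c =>
    ⟨Subalgebra.algebraMap_mem _ c, fun f hf => by
      simpa [Module.algebraMap_end_apply] using (span K S).smul_mem c hf⟩

end Operators

end ToricDiffOp

end

/-! An operator `P` in `diffOpTorus` is a sum of homogeneous components `t^e f_e(s)`, with `f_e` a
polynomial evaluated at the exponent, and `P` preserves `K[S]` exactly when each `f_e` vanishes on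
`{y ∈ S : y + e ∉ S}`. Transposition for the constant-term pairing is an anti-automorphism of
`diffOpTorus`; it turns `f_e(s)` into `f_e(-s - e)`.

Hence `P ∈ D(S)` is equivalent to `P^* ∈ D(ω(S))` once `f_e` vanishes on `S \ (S - e)` if and only
if `f_e(-s - e)` vanishes on `ω(S) \ (ω(S) - e)`. The two implications are
`eval_eq_zero_of_mem_omega` and `eval_eq_zero_of_mem`. Both rest on Zariski density: a polynomial
vanishing on a translate of `ℕ(A ∩ ρ)` vanishes on the corresponding translate of `Kρ`, which
absorbs the shifts `β ρ`. The conditions defining `𝓑` make the holes of `S` compatible along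
inclusions of faces.

If `ω(S) = a + S`, following transposition by conjugation with `t^{-a}` gives an isomorphism of
`D(S)` with its opposite algebra, and both correspondences follow. -/

noncomputable section

namespace ToricDiffOp

/-! ### Lattice points and faces of the cone. -/

section Lattice

variable {d : ℕ}

/-- Integer vectors as real vectors, as an additive map. -/
def toRealHom (d : ℕ) : (Fin d → ℤ) →+ (Fin d → ℝ) where
  toFun := toReal
  map_zero' := by ext; simp [toReal]
  map_add' _ _ := by ext; simp [toReal]

theorem toReal_add (x y : Fin d → ℤ) : toReal (x + y) = toReal x + toReal y :=
  (toRealHom d).map_add x y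

theorem toReal_sub (x y : Fin d → ℤ) : toReal (x - y) = toReal x - toReal y :=
  (toRealHom d).map_sub x y

variable {A : Finset (Fin d → ℤ)} {τ ρ : PointedCone ℝ (Fin d → ℝ)}

open scoped Classical in
/-- The generators `A ∩ τ` lying on `τ`. -/
def faceGens (A : Finset (Fin d → ℤ)) (τ : PointedCone ℝ (Fin d → ℝ)) : Finset (Fin d → ℤ) :=
  A.filter fun a => toReal a ∈ τ

theorem mem_faceGens {a : Fin d → ℤ} : a ∈ faceGens A τ ↔ a ∈ A ∧ toReal a ∈ τ := by
  simp [faceGens]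

theorem coe_faceGens : (faceGens A τ : Set (Fin d → ℤ)) = {a | a ∈ A ∧ toReal a ∈ τ} := by
  ext; simp [mem_faceGens]

/-- The monoid `ℕ(A ∩ τ)`. -/
def faceMonoid (A : Finset (Fin d → ℤ)) (τ : PointedCone ℝ (Fin d → ℝ)) :
    AddSubmonoid (Fin d → ℤ) :=
  AddSubmonoid.closure (faceGens A τ : Set (Fin d → ℤ))

/-- The sum of the generators lying on `τ`. -/
def faceSum (A : Finset (Fin d → ℤ)) (τ : PointedCone ℝ (Fin d → ℝ)) : Fin d → ℤ :=
  ∑ a ∈ faceGens A τ, a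

theorem faceMonoid_le_monoidOf : faceMonoid A τ ≤ monoidOf A :=
  AddSubmonoid.closure_mono fun _ ha => (mem_faceGens.1 ha).1

theorem faceMonoid_subset_faceLattice {u : Fin d → ℤ} (hu : u ∈ faceMonoid A τ) :
    u ∈ faceLattice A τ := by
  induction hu using AddSubmonoid.closure_induction with
  | mem x hx => exact AddSubgroup.subset_closure (mem_faceGens.1 hx)
  | zero => exact zero_mem _
  | add x y _ _ hx hy => exact add_mem hx hy

theorem toReal_mem_of_mem_faceMonoid {u : Fin d → ℤ} (hu : u ∈ faceMonoid A τ) :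
    toReal u ∈ τ := by
  induction hu using AddSubmonoid.closure_induction with
  | mem x hx => exact (mem_faceGens.1 hx).2
  | zero => exact (congrArg (· ∈ τ) (toRealHom d).map_zero).mpr (zero_mem τ)
  | add x y _ _ hx hy => exact toReal_add x y ▸ add_mem hx hy

theorem toReal_mem_coneOf_of_mem {a : Fin d → ℤ} (ha : a ∈ A) : toReal a ∈ coneOf A :=
  Submodule.subset_span ⟨a, ha, rfl⟩

theorem toReal_mem_coneOf {u : Fin d → ℤ} (hu : u ∈ monoidOf A) : toReal u ∈ coneOf A := by
  induction hu using AddSubmonoid.closure_induction with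
  | mem x hx => exact toReal_mem_coneOf_of_mem hx
  | zero => exact (congrArg (· ∈ coneOf A) (toRealHom d).map_zero).mpr (zero_mem _)
  | add x y _ _ hx hy => exact toReal_add x y ▸ add_mem hx hy

theorem exists_sub_of_mem_faceLattice {l : Fin d → ℤ} (hl : l ∈ faceLattice A τ) :
    ∃ u ∈ faceMonoid A τ, ∃ v ∈ faceMonoid A τ, l = u - v := by
  induction hl using AddSubgroup.closure_induction with
  | mem x hx =>
    exact ⟨x, AddSubmonoid.subset_closure (mem_faceGens.2 hx), 0, zero_mem _, by simp⟩
  | zero => exact ⟨0, zero_mem _, 0, zero_mem _, by simp⟩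
  | add x y _ _ hx hy =>
    obtain ⟨u, hu, v, hv, rfl⟩ := hx
    obtain ⟨u', hu', v', hv', rfl⟩ := hy
    exact ⟨u + u', add_mem hu hu', v + v', add_mem hv hv', by abel⟩
  | neg x _ hx =>
    obtain ⟨u, hu, v, hv, rfl⟩ := hx
    exact ⟨v, hv, u, hu, by abel⟩

theorem faceLattice_mono (h : τ ≤ ρ) : faceLattice A τ ≤ faceLattice A ρ :=
  AddSubgroup.closure_mono fun _ ha => ⟨ha.1, h ha.2⟩

theorem faceSum_mem : faceSum A τ ∈ faceMonoid A τ :=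
  sum_mem fun _ ha => AddSubmonoid.subset_closure ha

theorem add_mem_localization {S : Set (Fin d → ℤ)} {x l : Fin d → ℤ}
    (hx : x ∈ localization A S τ) (hl : l ∈ faceLattice A τ) : x + l ∈ localization A S τ := by
  obtain ⟨s, hs, l', hl', rfl⟩ := hx
  exact ⟨s, hs, l' + l, add_mem hl' hl, by abel⟩

theorem add_mem_localization_of_isNASet {S : Set (Fin d → ℤ)} (hS : IsNASet A S)
    {x u : Fin d → ℤ} (hx : x ∈ localization A S τ) (hu : u ∈ monoidOf A) :
    x + u ∈ localization A S τ := by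
  obtain ⟨s, hs, l', hl', rfl⟩ := hx
  exact ⟨s + u, hS s hs u hu, l', hl', by abel⟩

/-- Adding the negative part of the lattice vector leaves a sum of an element of `S` and monoid
elements. The resulting translate of `ℕ(A ∩ τ)` inside `S` is what the density argument needs. -/
theorem exists_forall_add_mem_of_mem_localization {S : Set (Fin d → ℤ)} (hS : IsNASet A S)
    {x : Fin d → ℤ} (hx : x ∈ localization A S τ) :
    ∃ v₀ ∈ faceMonoid A τ, ∀ v ∈ faceMonoid A τ, x + v₀ + v ∈ S := by
  obtain ⟨s, hs, l, hl, rfl⟩ := hx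
  obtain ⟨u, hu, v, hv, rfl⟩ := exists_sub_of_mem_faceLattice hl
  refine ⟨v, hv, fun w hw => ?_⟩
  have := hS s hs (u + w) (faceMonoid_le_monoidOf (add_mem hu hw))
  rwa [show s + (u - v) + v + w = s + (u + w) by abel]

/-- A point of a face is a nonnegative combination of generators, and the face property puts every
summand with positive coefficient on that face. So a face is determined by the generators it
contains. -/
theorem le_of_faceGens (hτ : τ.IsFaceOf (coneOf A))
    (h : ∀ a ∈ A, toReal a ∈ τ → toReal a ∈ ρ) : τ ≤ ρ := by
  intro x hx
  have hxC := hτ.le hx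
  revert hx
  unfold coneOf PointedCone.hull at hxC
  induction hxC using Submodule.span_induction with
  | mem x hx =>
    obtain ⟨a, ha, rfl⟩ := hx
    exact h a ha
  | zero => exact fun _ => zero_mem _
  | add x y hx hy ihx ihy =>
    intro hxy
    exact add_mem (ihx (hτ.mem_of_add_mem_left hx hy hxy))
      (ihy (hτ.mem_of_add_mem_right hx hy hxy))
  | smul c x hx ih =>
    intro hcx
    rcases eq_or_lt_of_le c.2 with hc | hc
    · have : c = 0 := Subtype.ext hc.symm
      simp [this]
    · refine Submodule.smul_mem _ _ (ih (hτ.mem_of_smul_add_mem hx (zero_mem _) hc ?_))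
      simpa using hcx

theorem finite_faces (A : Finset (Fin d → ℤ)) :
    {τ : PointedCone ℝ (Fin d → ℝ) | τ.IsFaceOf (coneOf A)}.Finite := by
  refine Set.Finite.of_injOn (f := faceGens A) (t := (A.powerset : Set (Finset (Fin d → ℤ))))
    ?_ ?_ (Finset.finite_toSet _)
  · intro τ _
    exact Finset.mem_coe.2 (Finset.mem_powerset.2 fun a ha => (mem_faceGens.1 ha).1)
  · intro τ hτ ρ hρ h
    refine le_antisymm (le_of_faceGens hτ fun a ha haτ => ?_)
      (le_of_faceGens hρ fun a ha haρ => ?_)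
    · exact (mem_faceGens.1 (h ▸ mem_faceGens.2 ⟨ha, haτ⟩)).2
    · exact (mem_faceGens.1 (h.symm ▸ mem_faceGens.2 ⟨ha, haρ⟩)).2

/-- The sum of the generators acts as a relative interior point of `τ`: a face containing it
contains every summand. -/
theorem toReal_faceSum_notMem (hτ : τ.IsFaceOf (coneOf A)) (hρ : ρ.IsFaceOf (coneOf A))
    (h : ¬ τ ≤ ρ) : toReal (faceSum A τ) ∉ ρ := by
  refine fun hw => h (le_of_faceGens hτ fun a ha haτ => ?_)
  have haG : a ∈ faceGens A τ := mem_faceGens.2 ⟨ha, haτ⟩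
  rw [faceSum, ← Finset.add_sum_erase _ _ haG, toReal_add] at hw
  refine hρ.mem_of_add_mem_left (toReal_mem_coneOf_of_mem ha) (toReal_mem_coneOf ?_) hw
  exact sum_mem fun b hb => AddSubmonoid.subset_closure
    (mem_faceGens.1 (Finset.mem_of_mem_erase hb)).1

/-- Elements of the cone that lie in the linear span of a face lie on that face. -/
theorem mem_of_mem_span (hρ : ρ.IsFaceOf (coneOf A)) {x : Fin d → ℝ} (hx : x ∈ coneOf A)
    (hxs : x ∈ Submodule.span ℝ (ρ : Set (Fin d → ℝ))) : x ∈ ρ := by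
  -- The linear span of a cone is its set of differences; then `x + v = u` lies on `ρ`, so `x` does.
  obtain ⟨u, hu, v, hv, h⟩ : ∃ u ∈ ρ, ∃ v ∈ ρ, x = u - v := by
    clear hx
    induction hxs using Submodule.span_induction with
    | mem x hx => exact ⟨x, hx, 0, zero_mem _, by simp⟩
    | zero => exact ⟨0, zero_mem _, 0, zero_mem _, by simp⟩
    | add x y _ _ hx hy =>
      obtain ⟨u, hu, v, hv, rfl⟩ := hx
      obtain ⟨u', hu', v', hv', rfl⟩ := hy
      exact ⟨u + u', add_mem hu hu', v + v', add_mem hv hv', by abel⟩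
    | smul c x _ hx =>
      obtain ⟨u, hu, v, hv, rfl⟩ := hx
      rcases le_total 0 c with hc | hc
      · exact ⟨c • u, ρ.smul_mem hc hu, c • v, ρ.smul_mem hc hv, smul_sub _ _ _⟩
      · exact ⟨(-c) • v, ρ.smul_mem (neg_nonneg.2 hc) hv, (-c) • u,
          ρ.smul_mem (neg_nonneg.2 hc) hu, by module⟩
  refine hρ.mem_of_add_mem_left hx (hρ.le hv) ?_
  rwa [h, sub_add_cancel]

/-- By dimension, a face strictly above a facet spans the whole space, so it contains all of `A`. -/
theorem eq_or_faceLattice_eq_top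
    (hA : AddSubgroup.closure (A : Set (Fin d → ℤ)) = ⊤) {σ : PointedCone ℝ (Fin d → ℝ)}
    (hσ : IsFacet A σ) (hρ : ρ.IsFaceOf (coneOf A)) (h : σ ≤ ρ) :
    ρ = σ ∨ ¬ IsFacet A ρ ∧ faceLattice A ρ = ⊤ := by
  have hle : Submodule.span ℝ (σ : Set (Fin d → ℝ)) ≤ Submodule.span ℝ (ρ : Set (Fin d → ℝ)) :=
    Submodule.span_mono h
  rcases hle.eq_or_lt with heq | hlt
  · left
    refine le_antisymm (fun x hx => mem_of_mem_span hσ.1 (hρ.le hx) ?_) h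
    rw [heq]
    exact Submodule.subset_span hx
  · right
    have h1 := Submodule.finrank_lt_finrank_of_lt hlt
    have h2 := Submodule.finrank_le (Submodule.span ℝ (ρ : Set (Fin d → ℝ)))
    have h3 := hσ.2
    rw [Module.finrank_fin_fun] at h2
    have htop : Submodule.span ℝ (ρ : Set (Fin d → ℝ)) = ⊤ := by
      apply Submodule.eq_top_of_finrank_eq
      rw [Module.finrank_fin_fun]
      omega
    refine ⟨fun hf => by have := hf.2; omega, ?_⟩
    rw [eq_top_iff, ← hA, faceLattice]
    refine AddSubgroup.closure_mono fun a ha => ⟨ha, mem_of_mem_span hρ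
      (toReal_mem_coneOf_of_mem ha) ?_⟩
    rw [htop]
    trivial

/-- Going far enough in a direction `-w` with `w` in the monoid but not on the face `ρ` leaves
`ℕA + ℤ(A ∩ ρ)`. -/
theorem eventually_notMem_monoid_add_faceLattice (hρ : ρ.IsFaceOf (coneOf A))
    {w : Fin d → ℤ} (hwA : w ∈ monoidOf A) (hw : toReal w ∉ ρ) (c : Fin d → ℤ) :
    ∀ᶠ n : ℕ in Filter.atTop, ¬ ∃ u ∈ monoidOf A, ∃ l ∈ faceLattice A ρ, c - n • w = u + l := by
  by_contra hcon
  rw [Filter.not_eventually] at hcon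
  simp only [not_not] at hcon
  obtain ⟨φ, hφ, h⟩ := Filter.extraction_of_frequently_atTop hcon
  choose u hu l hl hul using h
  have hk : ∀ n, ∃ k : A → ℕ, ∑ a, k a • (a : Fin d → ℤ) = u n := fun n => by
    obtain ⟨k, hk⟩ := AddSubmonoid.mem_closure_finset'.1 (hu n)
    exact ⟨k, hk.symm⟩
  choose k hk using hk
  -- Dickson's lemma: two of the infinitely many coefficient vectors are comparable, so `u j - u i`
  -- lies in `ℕA`. Subtracting the two equations puts a positive multiple of `w` plus this element
  -- in `ℤ(A ∩ ρ)`.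
  have : WellQuasiOrderedLE (A → ℕ) := inferInstance
  obtain ⟨i, j, hij, hkij⟩ := wellQuasiOrdered_le k
  have hdiff : u j - u i ∈ monoidOf A := by
    rw [← hk i, ← hk j, ← Finset.sum_sub_distrib]
    refine sum_mem fun a _ => ?_
    obtain ⟨e, he⟩ := Nat.exists_eq_add_of_le (hkij a)
    rw [he, add_smul, add_sub_cancel_left]
    exact nsmul_mem (AddSubmonoid.subset_closure a.2) e
  obtain ⟨e, he⟩ := Nat.exists_eq_add_of_lt (hφ hij)
  obtain ⟨p, hp, q, hq, hpq⟩ := exists_sub_of_mem_faceLattice (sub_mem (hl i) (hl j))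
  -- One copy of `w` is split off as a summand of a point of `ρ`, so the face property forces `w`
  -- onto `ρ`.
  have hsum : w + (e • w + (u j - u i) + q) = p := by
    have h1 := hul i
    have h2 := hul j
    rw [he, add_smul, add_smul, one_smul] at h2
    have h3 : p = l i - l j + q := by rw [hpq]; abel
    have h4 : l i = c - φ i • w - u i := by rw [h1]; abel
    have h5 : l j = c - (φ i • w + e • w + w) - u j := by rw [h2]; abel
    rw [h3, h4, h5]
    abel
  apply hw
  refine hρ.mem_of_add_mem_left (toReal_mem_coneOf hwA) (toReal_mem_coneOf ?_)
    (y := toReal (e • w + (u j - u i) + q)) ?_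
  · exact add_mem (add_mem (nsmul_mem hwA e) hdiff) (faceMonoid_le_monoidOf hq)
  · rw [← toReal_add, hsum]
    exact toReal_mem_of_mem_faceMonoid hp

theorem eventually_notMem_localization (hρ : ρ.IsFaceOf (coneOf A)) {S Sc : Set (Fin d → ℤ)}
    (hSc : IsFinGen A Sc) (hSSc : S ⊆ Sc) {w : Fin d → ℤ} (hwA : w ∈ monoidOf A)
    (hw : toReal w ∉ ρ) (c : Fin d → ℤ) :
    ∀ᶠ n : ℕ in Filter.atTop, c - n • w ∉ localization A S ρ := by
  obtain ⟨G, rfl⟩ := hSc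
  have := (Filter.eventually_all_finset G).2 fun g _ =>
    eventually_notMem_monoid_add_faceLattice hρ hwA hw (c - g)
  filter_upwards [this] with n hn
  rintro ⟨s, hs, l, hl, h⟩
  obtain ⟨g, hg, u, hu, rfl⟩ := hSSc hs
  exact hn g hg ⟨u, hu, l, hl, by rw [sub_right_comm, h]; abel⟩

end Lattice

/-! ### Zariski density of face monoids. -/

section Zariski

variable {K : Type*} [Field K] {d : ℕ}

/-- An integer vector as a vector over `K`. -/
def toField (K : Type*) [Field K] (z : Fin d → ℤ) : Fin d → K := fun i => (z i : K)

variable {A : Finset (Fin d → ℤ)} {τ : PointedCone ℝ (Fin d → ℝ)}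

theorem mem_spanLattice {x : Fin d → ℤ} : x ∈ spanLattice K A τ ↔
    toField K x ∈ Submodule.span K (toField K '' {a | a ∈ A ∧ toReal a ∈ τ}) :=
  Iff.rfl

theorem toField_add (x y : Fin d → ℤ) : toField K (x + y) = toField K x + toField K y := by
  ext; simp [toField]

theorem toField_sub (x y : Fin d → ℤ) : toField K (x - y) = toField K x - toField K y := by
  ext; simp [toField]

theorem sub_mem_spanLattice {x y : Fin d → ℤ} (hx : x ∈ spanLattice K A τ)
    (hy : y ∈ spanLattice K A τ) : x - y ∈ spanLattice K A τ := by
  rw [mem_spanLattice] at hx hy ⊢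
  exact toField_sub (K := K) x y ▸ sub_mem hx hy

theorem faceMonoid_subset_spanLattice {u : Fin d → ℤ} (hu : u ∈ faceMonoid A τ) :
    u ∈ spanLattice K A τ := by
  induction hu using AddSubmonoid.closure_induction with
  | mem x hx => exact Submodule.subset_span ⟨x, mem_faceGens.1 hx, rfl⟩
  | zero =>
    rw [mem_spanLattice, show toField K (0 : Fin d → ℤ) = 0 by ext; simp [toField]]
    exact zero_mem _
  | add x y _ _ hx hy =>
    rw [mem_spanLattice] at hx hy ⊢
    exact toField_add (K := K) x y ▸ add_mem hx hy

open MvPolynomial in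
/-- The Zariski closure of `x + ℕ(A ∩ τ)` contains `x + Kτ`. -/
theorem eval_eq_zero_of_faceMonoid [CharZero K] (f : MvPolynomial (Fin d) K) (x : Fin d → ℤ)
    (h : ∀ v ∈ faceMonoid A τ, eval (toField K (x + v)) f = 0)
    {z : Fin d → ℤ} (hz : z ∈ spanLattice K A τ) : eval (toField K (x + z)) f = 0 := by
  -- The pullback of `f` along the affine map `c ↦ x + ∑ c_b b`. It vanishes at all points with
  -- natural coordinates, hence identically in characteristic zero.
  let q : MvPolynomial (faceGens A τ) K :=
    bind₁ (fun i => C (x i : K) + ∑ b : faceGens A τ, X b * C ((b.1 i : ℤ) : K)) f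
  have hq (c : faceGens A τ → K) :
      eval c q = eval (fun i => (x i : K) + ∑ b : faceGens A τ, c b * ((b.1 i : ℤ) : K)) f := by
    change eval₂Hom (RingHom.id K) c (bind₁ _ f) = _
    rw [eval₂Hom_bind₁]
    change MvPolynomial.eval (fun i => MvPolynomial.eval c _) f = _
    simp
  have hq0 : q = 0 := by
    refine funext_set (fun _ => Set.range ((↑) : ℕ → K))
      (fun _ => Set.infinite_range_of_injective Nat.cast_injective) fun c hc => ?_
    choose n hn using fun b => hc b trivial
    rw [hq, map_zero, ← h (∑ b : faceGens A τ, n b • b.1) (sum_mem fun b _ =>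
      nsmul_mem (AddSubmonoid.subset_closure b.2) _)]
    congr 2
    ext i
    simp [toField, ← hn]
  have hz' : toField K z ∈ Submodule.span K (toField K '' (faceGens A τ : Set (Fin d → ℤ))) := by
    rw [coe_faceGens]
    exact hz
  obtain ⟨c, hc⟩ := Submodule.mem_span_image_finset_iff_exists_fun K |>.1 hz'
  have := hq c
  rw [hq0, map_zero] at this
  rw [this]
  congr 2
  ext i
  have hci := congrFun hc i
  rw [Finset.sum_apply] at hci
  simp only [toField, Pi.smul_apply, smul_eq_mul] at hci
  simp [toField, ← hci]

open MvPolynomial in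
theorem eval_eq_zero_of_faceMonoid_sub [CharZero K] (f : MvPolynomial (Fin d) K) (x : Fin d → ℤ)
    (h : ∀ v ∈ faceMonoid A τ, eval (toField K (x - v)) f = 0)
    {z : Fin d → ℤ} (hz : z ∈ spanLattice K A τ) : eval (toField K (x - z)) f = 0 := by
  let q : MvPolynomial (Fin d) K := bind₁ (fun i => -X i) f
  have hq (y : Fin d → ℤ) : eval (toField K y) q = eval (toField K (-y)) f := by
    change eval₂Hom (RingHom.id K) _ (bind₁ _ f) = _
    rw [eval₂Hom_bind₁]
    simp only [MvPolynomial.eval, coe_eval₂Hom, eval₂_neg, eval₂_X]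
    congr 1
    ext i
    simp [toField]
  have := eval_eq_zero_of_faceMonoid q (-x) (fun v hv => by
    rw [hq, neg_add, neg_neg, ← sub_eq_add_neg]; exact h v hv) hz
  rwa [hq, neg_add, neg_neg, ← sub_eq_add_neg] at this

end Zariski

/-! ### Vanishing conditions for `S` and for `ω(S)`. -/

section Omega

variable {K : Type*} [Field K] [CharZero K] {d : ℕ} {A : Finset (Fin d → ℤ)}
  {S Sc : Set (Fin d → ℤ)} {m : ℕ} {b : Fin m → Fin d → ℤ}
  {τ : Fin m → PointedCone ℝ (Fin d → ℝ)} {β : PointedCone ℝ (Fin d → ℝ) → Fin d → ℤ}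

theorem IsStandardExpression.subset (hS : IsStandardExpression A S Sc b τ) : S ⊆ Sc :=
  hS.eq_diff ▸ Set.sdiff_subset

theorem IsStandardExpression.isFaceOf (hS : IsStandardExpression A S Sc b τ)
    {ρ : PointedCone ℝ (Fin d → ℝ)} (hρ : ρ ∈ extFaces A τ) : ρ.IsFaceOf (coneOf A) := by
  rcases hρ with hρ | ⟨i, rfl⟩
  · exact hρ.1
  · exact hS.isFace i

theorem IsStandardExpression.notMem_faceCoset (hS : IsStandardExpression A S Sc b τ)
    {x : Fin d → ℤ} (hx : x ∈ S) (i : Fin m) : x ∉ faceCoset A (b i) (τ i) := by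
  rw [hS.eq_diff] at hx
  exact fun h => hx.2 (Set.mem_iUnion.2 ⟨i, h⟩)

/-- A point of `bᵢ + ℤ(A ∩ τᵢ)` does not lie in the localization of `S` at `τᵢ`. -/
theorem IsStandardExpression.add_notMem_localization (hS : IsStandardExpression A S Sc b τ)
    (i : Fin m) {l : Fin d → ℤ} (hl : l ∈ faceLattice A (τ i)) :
    b i + l ∉ localization A S (τ i) := by
  rintro ⟨s, hs, l', hl', h⟩
  exact hS.notMem_faceCoset hs i ⟨l - l', sub_mem hl hl', by rw [← add_sub_assoc, h]; abel⟩

theorem omega_isNASet (hSNA : IsNASet A S) : IsNASet A (omega A S τ β) := by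
  intro x hx u hu ρ hρ hmem
  refine hx ρ hρ ?_
  have := add_mem_localization_of_isNASet hSNA hmem hu
  rwa [show -(x + u) - β ρ + u = -x - β ρ by abel] at this

/-- A point satisfying the conditions of `ω(S)` at all faces containing `σ` can be moved into
`ω(S)` along `σ`. -/
theorem exists_add_mem_omega (hS : IsStandardExpression A S Sc b τ)
    {σ : PointedCone ℝ (Fin d → ℝ)} (hσ : σ.IsFaceOf (coneOf A)) {x : Fin d → ℤ}
    (hx : ∀ ρ ∈ extFaces A τ, σ ≤ ρ → -x - β ρ ∉ localization A S ρ) :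
    ∃ v ∈ faceMonoid A σ, x + v ∈ omega A S τ β := by
  have hfin : (extFaces A τ).Finite := (finite_faces A).subset fun ρ hρ => hS.isFaceOf hρ
  -- Multiples of `faceSum A σ` do not affect the conditions at faces containing `σ`, and eventually
  -- enforce those at the others. Finiteness of the set of faces gives a common `n`.
  have key : ∀ ρ ∈ extFaces A τ, ∀ᶠ n : ℕ in Filter.atTop,
      -(x + n • faceSum A σ) - β ρ ∉ localization A S ρ := by
    intro ρ hρ
    by_cases hle : σ ≤ ρ
    · refine Filter.Eventually.of_forall fun n hmem => hx ρ hρ hle ?_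
      have := add_mem_localization hmem (faceLattice_mono hle
        (faceMonoid_subset_faceLattice (nsmul_mem (faceSum_mem (A := A) (τ := σ)) n)))
      rwa [show -(x + n • faceSum A σ) - β ρ + n • faceSum A σ = -x - β ρ by abel] at this
    · filter_upwards [eventually_notMem_localization (hS.isFaceOf hρ) hS.isFinGen_closure
        hS.subset (faceMonoid_le_monoidOf faceSum_mem)
        (toReal_faceSum_notMem hσ (hS.isFaceOf hρ) hle) (-x - β ρ)] with n hn
      rwa [show -(x + n • faceSum A σ) - β ρ = -x - β ρ - n • faceSum A σ by abel]
  obtain ⟨n, hn⟩ := ((Filter.eventually_all_finite hfin).2 key).exists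
  exact ⟨n • faceSum A σ, nsmul_mem faceSum_mem n, hn⟩

/-- A face `ρ` at which `x + a` violates the condition yields a translate of `ℕ(A ∩ ρ)` inside `S \
(S - a)`; its Zariski closure contains `-x - a` because `β ρ ∈ Kρ`. -/
theorem eval_eq_zero_of_mem_omega (hSNA : IsNASet A S)
    (hβ : ∀ ρ ∈ extFaces A τ, β ρ ∈ spanLattice K A ρ) (f : MvPolynomial (Fin d) K)
    (a : Fin d → ℤ)
    (h : ∀ y ∈ S, y + a ∉ S → MvPolynomial.eval (toField K y) f = 0) {x : Fin d → ℤ}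
    (hx : x ∈ omega A S τ β) (hxa : x + a ∉ omega A S τ β) :
    MvPolynomial.eval (toField K (-x - a)) f = 0 := by
  obtain ⟨ρ, hρ, hmem⟩ : ∃ ρ ∈ extFaces A τ, -(x + a) - β ρ ∈ localization A S ρ := by
    by_contra! hcon
    exact hxa hcon
  obtain ⟨v₀, hv₀, hv⟩ := exists_forall_add_mem_of_mem_localization hSNA hmem
  have := eval_eq_zero_of_faceMonoid (τ := ρ) (A := A) f (-(x + a) - β ρ + v₀)
    (z := β ρ - v₀) (fun v hvm => h _ (hv v hvm) fun hmem' => hx ρ hρ ?_) ?_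
  · rwa [show -(x + a) - β ρ + v₀ + (β ρ - v₀) = -x - a by abel] at this
  · refine ⟨_, hmem', -(v₀ + v), neg_mem (faceMonoid_subset_faceLattice (add_mem hv₀ hvm)), ?_⟩
    abel
  · exact sub_mem_spanLattice (hβ ρ hρ) (faceMonoid_subset_spanLattice hv₀)

theorem eval_eq_zero_of_mem (hA : AddSubgroup.closure (A : Set (Fin d → ℤ)) = ⊤)
    (hS : IsStandardExpression A S Sc b τ) (hSNA : IsNASet A S)
    (hβ : β ∈ familiesB K A b τ) (f : MvPolynomial (Fin d) K) (a : Fin d → ℤ)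
    (h : ∀ x ∈ omega A S τ β, x + a ∉ omega A S τ β →
      MvPolynomial.eval (toField K (-x - a)) f = 0) {y : Fin d → ℤ}
    (hy : y ∈ S) (hya : y + a ∉ S) : MvPolynomial.eval (toField K y) f = 0 := by
  -- It suffices to find a face `σ` for which `-y - a - β σ` meets the conditions at all `ρ ⊇ σ`.
  -- Moving along `σ` then gives points of `ω(S)` whose translates by `a` fail the condition at `σ`,
  -- and density along `σ` returns to `y`.
  have key : ∀ σ ∈ extFaces A τ, (∀ ρ ∈ extFaces A τ, σ ≤ ρ →
      y + a + β σ - β ρ ∉ localization A S ρ) → MvPolynomial.eval (toField K y) f = 0 := by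
    intro σ hσ hρ
    obtain ⟨v₀, hv₀, hmem⟩ := exists_add_mem_omega (β := β) hS (hS.isFaceOf hσ)
      (x := -y - a - β σ) fun ρ hρ' hle => by
        rw [show -(-y - a - β σ) - β ρ = y + a + β σ - β ρ by abel]
        exact hρ ρ hρ' hle
    have := eval_eq_zero_of_faceMonoid_sub (τ := σ) (A := A) f (y + β σ - v₀)
      (z := β σ - v₀) (fun v hv => ?_) ?_
    · rwa [show y + β σ - v₀ - (β σ - v₀) = y by abel] at this
    · have hv' := omega_isNASet hSNA _ hmem v (faceMonoid_le_monoidOf hv)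
      have := h _ hv' fun hcon => hcon σ hσ ?_
      · rwa [show -(-y - a - β σ + v₀ + v) - a = y + β σ - v₀ - v by abel] at this
      · exact ⟨y, hy, -(v₀ + v), neg_mem (faceMonoid_subset_faceLattice (add_mem hv₀ hv)),
          by abel⟩
    · exact sub_mem_spanLattice (hβ.1 σ hσ) (faceMonoid_subset_spanLattice hv₀)
  by_cases hyc : y + a ∈ Sc
  · obtain ⟨i, l, hl, hil⟩ : ∃ i, y + a ∈ faceCoset A (b i) (τ i) := by
      by_contra! hcon
      exact hya (hS.eq_diff ▸ ⟨hyc, by simpa using hcon⟩)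
    -- When `y + a` lies in a removed coset, its face serves as `σ`: membership in `𝓑` carries this
    -- coset into a removed coset for each larger face.
    refine key (τ i) (Or.inr ⟨i, rfl⟩) fun ρ hρ hle => ?_
    obtain ⟨j, rfl, hj⟩ := hβ.2 i ρ hρ hle
    have := hS.add_notMem_localization j (add_mem hj (faceLattice_mono hle hl))
    rwa [show b j + (b i + β (τ i) - (b j + β (τ j)) + l) = b i + l + β (τ i) - β (τ j) by abel,
      ← hil] at this
  · rw [hS.isScored_closure] at hyc
    simp only [Set.mem_ofPred_eq, not_forall] at hyc
    obtain ⟨σ, F, hσ, hF, hFy⟩ := hyc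
    -- Outside the scored closure, `σ` is a facet whose support function detects this. The only
    -- other face above it is the whole cone; were that some `τ i`, the removed coset would be all
    -- of `ℤ^d`, contradicting `y ∈ S`.
    refine key σ (Or.inl hσ) fun ρ hρ hle => ?_
    rcases eq_or_faceLattice_eq_top hA hσ (hS.isFaceOf hρ) hle with rfl | ⟨hnot, htop⟩
    · rw [add_sub_cancel_right]
      rintro ⟨s, hs, l, hl, heq⟩
      refine hFy ⟨s, hS.subset hs, ?_⟩
      obtain ⟨u, hu, v, hv, rfl⟩ := exists_sub_of_mem_faceLattice hl
      simp [heq, toReal_add, toReal_sub, hF.eq_zero _ (toReal_mem_of_mem_faceMonoid hu),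
        hF.eq_zero _ (toReal_mem_of_mem_faceMonoid hv)]
    · rcases hρ with hρ | ⟨i, rfl⟩
      · exact absurd hρ hnot
      · exact absurd ⟨y - b i, htop ▸ AddSubgroup.mem_top _, by abel⟩
          (hS.notMem_faceCoset hy i)

end Omega

/-! ### Monomials and coefficients of operators. -/

section Transpose

variable {K : Type*} [Field K] {d : ℕ}

theorem laurent_hom_ext {N : Type*} [AddCommMonoid N] [Module K N] {f g : Laurent K d →ₗ[K] N}
    (h : ∀ b, f (monomial K b) = g (monomial K b)) : f = g :=
  (AddMonoidAlgebra.basis (Fin d → ℤ) K).ext h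

theorem coeff_monomial (b c : Fin d → ℤ) :
    (monomial K b).coeff c = if b = c then 1 else 0 := by
  classical
  rw [monomial, AddMonoidAlgebra.coeff_single, Finsupp.single_apply]

theorem mulMonomial_monomial (a b : Fin d → ℤ) :
    mulMonomial K a (monomial K b) = monomial K (a + b) := by
  simp [mulMonomial, monomial, AddMonoidAlgebra.single_mul_single]

theorem coeff_mulMonomial (a : Fin d → ℤ) (g : Laurent K d) (c : Fin d → ℤ) :
    (mulMonomial K a g).coeff c = g.coeff (c - a) := by
  simp [mulMonomial, monomial, sub_eq_neg_add]

theorem mulMonomial_mul_mulMonomial (a b : Fin d → ℤ) :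
    mulMonomial K a * mulMonomial K b = mulMonomial K (a + b) :=
  laurent_hom_ext fun c => by simp [mulMonomial_monomial, add_assoc]

theorem mulMonomial_zero : mulMonomial K (0 : Fin d → ℤ) = 1 :=
  laurent_hom_ext fun c => by simp [mulMonomial_monomial]

theorem mulMonomial_mul_neg (a : Fin d → ℤ) : mulMonomial K a * mulMonomial K (-a) = 1 := by
  rw [mulMonomial_mul_mulMonomial, add_neg_cancel, mulMonomial_zero]

theorem mulMonomial_neg_mul (a : Fin d → ℤ) : mulMonomial K (-a) * mulMonomial K a = 1 := by
  rw [mulMonomial_mul_mulMonomial, neg_add_cancel, mulMonomial_zero]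

theorem mulMonomial_mem (a : Fin d → ℤ) : mulMonomial K a ∈ diffOpTorus K d :=
  Algebra.subset_adjoin (Or.inl ⟨a, rfl⟩)

theorem partialDeriv_mem (j : Fin d) : partialDeriv K j ∈ diffOpTorus K d :=
  Algebra.subset_adjoin (Or.inr ⟨j, rfl⟩)

/-- The coefficient of `t^c`, as a linear form. -/
def coeffHom (K : Type*) [Field K] {d : ℕ} (c : Fin d → ℤ) : Laurent K d →ₗ[K] K :=
  Finsupp.lapply c ∘ₗ (AddMonoidAlgebra.coeffLinearEquiv K).toLinearMap

theorem coeffHom_apply (c : Fin d → ℤ) (g : Laurent K d) : coeffHom K c g = g.coeff c := rfl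

theorem coeff_partialDeriv (j : Fin d) (g : Laurent K d) (c : Fin d → ℤ) :
    (partialDeriv K j g).coeff c = ((c j : K) + 1) * g.coeff (c + Pi.single j 1) := by
  suffices h : coeffHom K c ∘ₗ partialDeriv K j =
      ((c j : K) + 1) • coeffHom K (c + Pi.single j 1) from LinearMap.congr_fun h g
  refine laurent_hom_ext fun b => ?_
  rw [LinearMap.comp_apply, partialDeriv_monomial, map_smul, LinearMap.smul_apply,
    coeffHom_apply, coeffHom_apply, coeff_monomial, coeff_monomial]
  simp only [sub_eq_iff_eq_add]
  split_ifs with h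
  · simp [h]
  · simp

/-! ### Polynomial symbols and membership in `D(S)`. -/

/-- The operator `P` has homogeneous components `t^a f_a(s)` with `f_a` polynomials in the Euler
operators. -/
def HasSymbol (P : Module.End K (Laurent K d))
    (f : (Fin d → ℤ) → MvPolynomial (Fin d) K) : Prop :=
  ∀ b c, (P (monomial K b)).coeff c = MvPolynomial.eval (toField K b) (f (c - b))

theorem exists_hasSymbol {P : Module.End K (Laurent K d)} (hP : P ∈ diffOpTorus K d) :
    ∃ f, HasSymbol P f := by
  -- Strengthening to left multiplication on any operator with a symbol makes the product case
  -- immediate and avoids convolving two symbols.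
  suffices h : ∀ Q : Module.End K (Laurent K d), (∃ f, HasSymbol Q f) →
      ∃ f, HasSymbol (P * Q) f by
    refine mul_one P ▸ h 1 ⟨fun a => if a = 0 then 1 else 0, fun b c => ?_⟩
    rw [Module.End.one_apply, coeff_monomial]
    simp only [sub_eq_zero, eq_comm (a := b)]
    split_ifs <;> simp
  induction hP using Algebra.adjoin_induction with
  | mem P hP =>
    rintro Q ⟨f, hf⟩
    rcases hP with ⟨a, rfl⟩ | ⟨j, rfl⟩
    · refine ⟨fun c => f (c - a), fun b c => ?_⟩
      rw [Module.End.mul_apply, coeff_mulMonomial, hf, sub_right_comm]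
    · refine ⟨fun c => (MvPolynomial.X j + MvPolynomial.C ((c j : K) + 1)) *
        f (c + Pi.single j 1), fun b c => ?_⟩
      rw [Module.End.mul_apply, coeff_partialDeriv, hf]
      simp [toField, sub_add_eq_add_sub]
  | algebraMap r =>
    rintro Q ⟨f, hf⟩
    exact ⟨fun c => r • f c, fun b c => by simp [hf b c]⟩
  | add P P' _ _ hP hP' =>
    intro Q hQ
    obtain ⟨f, hf⟩ := hP Q hQ
    obtain ⟨g, hg⟩ := hP' Q hQ
    refine ⟨fun c => f c + g c, fun b c => ?_⟩
    rw [map_add, ← hf, ← hg, add_mul]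
    simp
  | mul P P' _ _ hP hP' =>
    intro Q hQ
    rw [mul_assoc]
    exact hP _ (hP' _ hQ)

theorem mem_span_iff {S : Set (Fin d → ℤ)} {f : Laurent K d} :
    f ∈ span K S ↔ ∀ c ∉ S, f.coeff c = 0 := by
  rw [← AddMonoidAlgebra.mem_supported' (R := K), AddMonoidAlgebra.supported_eq_span_single]
  rfl

theorem monomial_mem_span {S : Set (Fin d → ℤ)} {b : Fin d → ℤ} (hb : b ∈ S) :
    monomial K b ∈ span K S :=
  Submodule.subset_span ⟨b, hb, rfl⟩

theorem mem_diffOp_iff {S : Set (Fin d → ℤ)} {P : Module.End K (Laurent K d)} :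
    P ∈ diffOp K S ↔ P ∈ diffOpTorus K d ∧
      ∀ b ∈ S, ∀ c ∉ S, (P (monomial K b)).coeff c = 0 := by
  refine and_congr_right fun _ => ⟨fun h b hb => mem_span_iff.1 (h _ (monomial_mem_span hb)),
    fun h f hf => ?_⟩
  refine (Submodule.span_le.2 ?_ : span K S ≤ (span K S).comap P) hf
  rintro _ ⟨b, hb, rfl⟩
  exact mem_span_iff.2 (h b hb)

/-! ### The constant-term pairing and transposes. -/

/-- The bilinear form `(f, g) ↦` constant term of `f * g`. -/
def constPairing (K : Type*) [Field K] (d : ℕ) : Laurent K d →ₗ[K] Laurent K d →ₗ[K] K :=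
  (LinearMap.mul K (Laurent K d)).compr₂ (coeffHom K 0)

theorem constPairing_apply (f g : Laurent K d) : constPairing K d f g = (f * g).coeff 0 := rfl

theorem constPairing_comm (f g : Laurent K d) :
    constPairing K d f g = constPairing K d g f := by
  rw [constPairing_apply, mul_comm, constPairing_apply]

theorem constPairing_monomial_right (f : Laurent K d) (c : Fin d → ℤ) :
    constPairing K d f (monomial K c) = f.coeff (-c) := by
  simp [constPairing_apply, monomial]

theorem constPairing_monomial_left (c : Fin d → ℤ) (f : Laurent K d) :
    constPairing K d (monomial K c) f = f.coeff (-c) := by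
  rw [constPairing_comm, constPairing_monomial_right]

/-- `Q` is the transpose of `P` for the pairing by constant terms. -/
abbrev IsTranspose (P Q : Module.End K (Laurent K d)) : Prop :=
  LinearMap.IsAdjointPair (constPairing K d) (constPairing K d) P Q

theorem isTranspose_iff {P Q : Module.End K (Laurent K d)} : IsTranspose P Q ↔
    ∀ b c, (P (monomial K b)).coeff (-c) = (Q (monomial K c)).coeff (-b) := by
  constructor
  · intro h b c
    rw [← constPairing_monomial_right, ← constPairing_monomial_left]
    exact h _ _
  · intro h
    rw [IsTranspose, LinearMap.isAdjointPair_iff_comp_eq_compl₂]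
    refine laurent_hom_ext fun b => laurent_hom_ext fun c => ?_
    rw [LinearMap.comp_apply, LinearMap.compl₂_apply, constPairing_monomial_right,
      constPairing_monomial_left]
    exact h b c

theorem IsTranspose.symm {P Q : Module.End K (Laurent K d)} (h : IsTranspose P Q) :
    IsTranspose Q P := fun f g => by
  rw [constPairing_comm, ← h, constPairing_comm]

theorem IsTranspose.unique {P Q Q' : Module.End K (Laurent K d)} (h : IsTranspose P Q)
    (h' : IsTranspose P Q') : Q = Q' := by
  refine LinearMap.ext fun g => AddMonoidAlgebra.ext (Finsupp.ext fun c => ?_)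
  rw [← neg_neg c, ← constPairing_monomial_left, ← constPairing_monomial_left, ← h, ← h']

theorem isTranspose_mulMonomial (a : Fin d → ℤ) :
    IsTranspose (mulMonomial K a) (mulMonomial K a) := fun f g => by
  simp [constPairing_apply, mulMonomial, mul_left_comm, mul_assoc]

/-- Integration by parts: `t_j ∂_j` kills constant terms, and the extra `t_j^{-1}` comes from
differentiating `t_j^{-1} g`. -/
theorem isTranspose_partialDeriv (j : Fin d) :
    IsTranspose (partialDeriv K j) (mulMonomial K (-Pi.single j 1) - partialDeriv K j) := by
  rw [isTranspose_iff]
  intro b c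
  rw [LinearMap.sub_apply, AddMonoidAlgebra.coeff_sub, Finsupp.sub_apply, mulMonomial_monomial,
    coeff_monomial, coeff_partialDeriv, coeff_partialDeriv, coeff_monomial, coeff_monomial]
  have h1 : (-Pi.single j 1 + c = -b) ↔ b = -c + Pi.single j 1 := by
    constructor
    · intro h; rw [← neg_neg b, ← h]; abel
    · rintro rfl; abel
  have h2 : (c = -b + Pi.single j 1) ↔ b = -c + Pi.single j 1 := by
    constructor
    · rintro rfl; abel
    · rintro rfl; abel
  simp only [h1, h2]
  split_ifs with h
  · simp [h, sub_eq_neg_add, add_comm]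
  · simp

theorem exists_isTranspose {P : Module.End K (Laurent K d)} (hP : P ∈ diffOpTorus K d) :
    ∃ Q ∈ diffOpTorus K d, IsTranspose P Q := by
  induction hP using Algebra.adjoin_induction with
  | mem P hP =>
    rcases hP with ⟨a, rfl⟩ | ⟨j, rfl⟩
    · exact ⟨_, mulMonomial_mem a, isTranspose_mulMonomial a⟩
    · exact ⟨_, sub_mem (mulMonomial_mem _) (partialDeriv_mem j), isTranspose_partialDeriv j⟩
  | algebraMap r =>
    exact ⟨_, Subalgebra.algebraMap_mem _ r, fun f g => by simp [constPairing_apply]⟩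
  | add P P' _ _ hP hP' =>
    obtain ⟨Q, hQ, h⟩ := hP
    obtain ⟨Q', hQ', h'⟩ := hP'
    exact ⟨Q + Q', add_mem hQ hQ', h.add h'⟩
  | mul P P' _ _ hP hP' =>
    obtain ⟨Q, hQ, h⟩ := hP
    obtain ⟨Q', hQ', h'⟩ := hP'
    exact ⟨Q' * Q, mul_mem hQ' hQ, h.mul h'⟩

/-! ### Translates of `S`, and transposition between `D(S)` and `D(ω(S))`. -/

theorem mulMonomial_conj_mem_diffOp_translate {S : Set (Fin d → ℤ)} (a : Fin d → ℤ)
    {Q : Module.End K (Laurent K d)} (hQ : Q ∈ diffOp K S) :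
    mulMonomial K a * Q * mulMonomial K (-a) ∈ diffOp K (translate a S) := by
  rw [mem_diffOp_iff] at hQ ⊢
  refine ⟨mul_mem (mul_mem (mulMonomial_mem a) hQ.1) (mulMonomial_mem _), ?_⟩
  rintro _ ⟨s, hs, rfl⟩ c hc
  rw [Module.End.mul_apply, Module.End.mul_apply, mulMonomial_monomial, coeff_mulMonomial,
    neg_add_cancel_left]
  exact hQ.2 s hs _ fun h => hc ⟨_, h, by abel⟩

theorem translate_neg_translate (a : Fin d → ℤ) (S : Set (Fin d → ℤ)) :
    translate (-a) (translate a S) = S := by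
  ext z
  constructor
  · rintro ⟨_, ⟨s, hs, rfl⟩, rfl⟩
    rwa [neg_add_cancel_left]
  · exact fun hz => ⟨_, ⟨z, hz, rfl⟩, by abel⟩

theorem mulMonomial_conj_mem_diffOp {S : Set (Fin d → ℤ)} (a : Fin d → ℤ)
    {P : Module.End K (Laurent K d)} (hP : P ∈ diffOp K (translate a S)) :
    mulMonomial K (-a) * P * mulMonomial K a ∈ diffOp K S := by
  have := mulMonomial_conj_mem_diffOp_translate (-a) hP
  rwa [translate_neg_translate, neg_neg] at this

theorem mulMonomial_conj_conj (a : Fin d → ℤ) (P : Module.End K (Laurent K d)) :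
    mulMonomial K a * (mulMonomial K (-a) * P * mulMonomial K a) * mulMonomial K (-a) = P := by
  rw [mul_assoc, mul_assoc, mulMonomial_mul_neg, mul_one, ← mul_assoc, mulMonomial_mul_neg,
    one_mul]

theorem diffOp_translate (a : Fin d → ℤ) (S : Set (Fin d → ℤ)) :
    (diffOp K (translate a S) : Set (Module.End K (Laurent K d))) =
      {P | ∃ Q ∈ diffOp K S, P = mulMonomial K a * Q * mulMonomial K (-a)} := by
  ext P
  constructor
  · exact fun hP => ⟨_, mulMonomial_conj_mem_diffOp a hP, (mulMonomial_conj_conj a P).symm⟩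
  · rintro ⟨Q, hQ, rfl⟩
    exact mulMonomial_conj_mem_diffOp_translate a hQ

variable [CharZero K] {A : Finset (Fin d → ℤ)}
  {S Sc : Set (Fin d → ℤ)} {m : ℕ} {b : Fin m → Fin d → ℤ}
  {τ : Fin m → PointedCone ℝ (Fin d → ℝ)} {β : PointedCone ℝ (Fin d → ℝ) → Fin d → ℤ}

/-- Transposition exchanges `D(S)` and `D(ω(S))`. -/
theorem mem_diffOp_iff_of_isTranspose (hA : AddSubgroup.closure (A : Set (Fin d → ℤ)) = ⊤)
    (hS : IsStandardExpression A S Sc b τ) (hSNA : IsNASet A S)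
    (hβ : β ∈ familiesB K A b τ) {P Q : Module.End K (Laurent K d)}
    (hP : P ∈ diffOpTorus K d) (hQ : Q ∈ diffOpTorus K d) (h : IsTranspose P Q) :
    P ∈ diffOp K S ↔ Q ∈ diffOp K (omega A S τ β) := by
  obtain ⟨f, hf⟩ := exists_hasSymbol hP
  -- The transpose keeps the degree `c - x` and evaluates its symbol at `-c`, written to match the
  -- vanishing lemmas.
  have hQf (x c : Fin d → ℤ) : (Q (monomial K x)).coeff c =
      MvPolynomial.eval (toField K (-x - (c - x))) (f (c - x)) := by
    have := isTranspose_iff.1 h (-c) x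
    rw [neg_neg, hf] at this
    rw [← this, show -x - (c - x) = -c by abel, show -x - -c = c - x by abel]
  simp only [mem_diffOp_iff, hP, hQ, true_and, hQf]
  constructor
  · intro hPS x hx c hc
    refine eval_eq_zero_of_mem_omega hSNA hβ.1 (f (c - x)) (c - x) (fun y hy hya => ?_) hx ?_
    · rw [← hPS y hy _ hya, hf, add_sub_cancel_left]
    · rwa [add_sub_cancel]
  · intro hQω y hy c hc
    rw [hf]
    refine eval_eq_zero_of_mem hA hS hSNA hβ (f (c - y)) (c - y) (fun x hx hxa => ?_) hy ?_
    · rw [← hQω x hx _ hxa, add_sub_cancel_left]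
    · rwa [add_sub_cancel]

end Transpose

/-! ### The anti-automorphism of `D(S)`; modules and ideals. -/

section Opposite

variable {K : Type*} [Field K] {d : ℕ}

variable [CharZero K] {A : Finset (Fin d → ℤ)}
  {S Sc : Set (Fin d → ℤ)} {m : ℕ} {b : Fin m → Fin d → ℤ}
  {τ : Fin m → PointedCone ℝ (Fin d → ℝ)} {β : PointedCone ℝ (Fin d → ℝ) → Fin d → ℤ}

/-- A bijective anti-endomorphism as an isomorphism with the opposite algebra. -/
def algEquivOpOfAntiHom {K R : Type*} [Field K] [Ring R] [Algebra K R] (φ : R → R)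
    (hφ : Function.Bijective φ) (hadd : ∀ x y, φ (x + y) = φ x + φ y)
    (hmul : ∀ x y, φ (x * y) = φ y * φ x)
    (halg : ∀ r, φ (algebraMap K R r) = algebraMap K R r) : R ≃ₐ[K] Rᵐᵒᵖ :=
  AlgEquiv.ofBijective
    { toFun := fun x => MulOpposite.op (φ x)
      map_one' := by simpa using congrArg MulOpposite.op (halg 1)
      map_mul' := fun x y => by simp [hmul]
      map_zero' := by simpa using congrArg MulOpposite.op (halg 0)
      map_add' := fun x y => by simp [hadd]
      commutes' := fun r => congrArg MulOpposite.op (halg r) }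
    (MulOpposite.op_bijective.comp hφ)

/-- If `ω(S) = a + S`, then `P ↦ t^{-a} P^* t^a` is an anti-automorphism of `D(S)`. -/
theorem exists_algEquiv_op (hA : AddSubgroup.closure (A : Set (Fin d → ℤ)) = ⊤)
    (hS : IsStandardExpression A S Sc b τ) (hSNA : IsNASet A S)
    (hβ : β ∈ familiesB K A b τ) {a : Fin d → ℤ} (ha : omega A S τ β = translate a S) :
    Nonempty (diffOp K S ≃ₐ[K] (diffOp K S)ᵐᵒᵖ) := by
  have hex (P : diffOp K S) : ∃ Q : diffOp K S,
      IsTranspose P.1 (mulMonomial K a * Q.1 * mulMonomial K (-a)) := by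
    have hP : P.1 ∈ diffOpTorus K d := (mem_diffOp_iff.1 P.2).1
    obtain ⟨Q, hQ, h⟩ := exists_isTranspose hP
    have hQω := (mem_diffOp_iff_of_isTranspose hA hS hSNA hβ hP hQ h).1 P.2
    rw [ha] at hQω
    exact ⟨⟨_, mulMonomial_conj_mem_diffOp a hQω⟩, by rwa [mulMonomial_conj_conj]⟩
  choose φ hφ using hex
  -- Nondegeneracy of the pairing makes transposes unique, so each algebraic identity for `φ`
  -- reduces to exhibiting a transpose.
  have huniq (P Q : diffOp K S)
      (h : IsTranspose P.1 (mulMonomial K a * Q.1 * mulMonomial K (-a))) : φ P = Q := by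
    have h1 := (hφ P).unique h
    have h2 := congrArg (fun R => mulMonomial K (-a) * R * mulMonomial K a) h1
    have h3 := mulMonomial_conj_conj (K := K) (-a)
    rw [neg_neg] at h3
    simp only [h3] at h2
    exact Subtype.ext h2
  have hmul (P Q : diffOp K S) : φ (P * Q) = φ Q * φ P := by
    refine huniq _ _ ?_
    have h := (hφ P).mul (hφ Q)
    rw [Subalgebra.coe_mul, Subalgebra.coe_mul]
    have h2 : mulMonomial K a * ((φ Q).1 * (φ P).1) * mulMonomial K (-a) =
        (mulMonomial K a * (φ Q).1 * mulMonomial K (-a)) *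
        (mulMonomial K a * (φ P).1 * mulMonomial K (-a)) := by
      simp only [mul_assoc]
      rw [← mul_assoc (mulMonomial K (-a)) (mulMonomial K a), mulMonomial_neg_mul, one_mul]
    rwa [h2]
  have hadd (P Q : diffOp K S) : φ (P + Q) = φ P + φ Q := by
    refine huniq _ _ ?_
    rw [Subalgebra.coe_add, Subalgebra.coe_add, mul_add, add_mul]
    exact (hφ P).add (hφ Q)
  have halg (r : K) : φ (algebraMap K _ r) = algebraMap K _ r := by
    refine huniq _ _ ?_
    rw [Subalgebra.coe_algebraMap, ← Algebra.commutes, mul_assoc, mulMonomial_mul_neg, mul_one]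
    exact fun f g => by simp [constPairing_apply]
  have hbij : Function.Bijective φ := by
    constructor
    · intro P Q h
      have h1 := (hφ P).symm
      rw [h] at h1
      exact Subtype.ext (h1.unique (hφ Q).symm)
    · intro Q
      -- Transposition is symmetric, so a preimage of `Q` is the transpose of `t^a Q t^{-a}`, which
      -- lies in `D(ω(S))`.
      have hR := mulMonomial_conj_mem_diffOp_translate a Q.2
      have hRt := (mem_diffOp_iff.1 hR).1
      obtain ⟨P, hP, h⟩ := exists_isTranspose hRt
      have hPS : P ∈ diffOp K S := by
        rw [mem_diffOp_iff_of_isTranspose hA hS hSNA hβ hP hRt h.symm, ha]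
        exact hR
      exact ⟨⟨P, hPS⟩, huniq _ _ h.symm⟩
  exact ⟨algEquivOpOfAntiHom φ hbij hadd hmul halg⟩

/-- An anti-automorphism of an algebra identifies left modules with right modules. -/
theorem exists_moduleCat_equivalence {K R : Type*} [Field K] [Ring R] [Algebra K R]
    (φ : R ≃ₐ[K] Rᵐᵒᵖ) :
    ∃ E : ModuleCat R ≌ ModuleCat Rᵐᵒᵖ,
      Nonempty (E.functor ⋙ ModuleCat.restrictScalars (algebraMap K Rᵐᵒᵖ) ≅
        ModuleCat.restrictScalars (algebraMap K R)) := by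
  -- Restriction along `φ⁻¹` leaves the underlying group unchanged; compatibility with `K` is the
  -- `K`-linearity of `φ`.
  refine ⟨ModuleCat.restrictScalarsEquivalenceOfRingEquiv φ.symm.toRingEquiv,
    ⟨(ModuleCat.restrictScalarsComp' (algebraMap K Rᵐᵒᵖ) φ.symm.toRingEquiv.toRingHom
      (algebraMap K R) ?_).symm⟩⟩
  ext r
  exact (φ.symm.commutes r).symm

/-- An anti-automorphism of a ring identifies left ideals with right ideals. -/
def idealOrderIso {R : Type*} [Ring R] (φ : R ≃+* Rᵐᵒᵖ) : Submodule R R ≃o Submodule Rᵐᵒᵖ R :=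
  letI : RingHomInvPair (φ : R →+* Rᵐᵒᵖ) (φ.symm : Rᵐᵒᵖ →+* R) := RingHomInvPair.of_ringEquiv φ
  letI : RingHomInvPair (φ.symm : Rᵐᵒᵖ →+* R) (φ : R →+* Rᵐᵒᵖ) :=
    RingHomInvPair.of_ringEquiv φ.symm
  Submodule.orderIsoMapComap
    -- Read as a self-map of `R`, `φ` is semilinear from the left to the right regular module, so it
    -- matches their submodules.
    ({ toFun := fun x => (φ x).unop
       map_add' := by simp
       map_smul' := fun r x => by simp
       invFun := fun x => φ.symm (MulOpposite.op x)
       left_inv := fun x => by simp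
       right_inv := fun x => by simp } : R ≃ₛₗ[(φ : R →+* Rᵐᵒᵖ)] R)

end Opposite

end ToricDiffOp

end

/-- Left modules are `R`-modules and right modules are modules over the opposite ring `Rᵐᵒᵖ`.
The correspondence of modules is an equivalence of categories that preserves underlying `K`-vector
spaces; the correspondence of ideals is an isomorphism of ordered sets. -/
theorem mainTheorem8 (K : Type u) [Field K] [IsAlgClosed K] [CharZero K]
    (d : ℕ) (A : Finset (Fin d → ℤ))
    (hA : AddSubgroup.closure (A : Set (Fin d → ℤ)) = ⊤)
    (hcone : (ToricDiffOp.coneOf A : ConvexCone ℝ (Fin d → ℝ)).Salient)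
    (S Sc : Set (Fin d → ℤ)) (m : ℕ) (b : Fin m → Fin d → ℤ)
    (τ : Fin m → PointedCone ℝ (Fin d → ℝ))
    (hS : ToricDiffOp.IsStandardExpression A S Sc b τ)
    (hSNA : ToricDiffOp.IsNASet A S)
    (β : PointedCone ℝ (Fin d → ℝ) → Fin d → ℤ)
    (hβ : β ∈ ToricDiffOp.familiesB K A b τ)
    (a : Fin d → ℤ)
    (ha : ToricDiffOp.omega A S τ β = ToricDiffOp.translate a S) :
    ((ToricDiffOp.diffOp K (ToricDiffOp.translate a S) :
        Set (Module.End K (ToricDiffOp.Laurent K d))) =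
      {P | ∃ Q ∈ ToricDiffOp.diffOp K S,
        P = ToricDiffOp.mulMonomial K a * Q * ToricDiffOp.mulMonomial K (-a)}) ∧
    (∃ E : ModuleCat.{v} (ToricDiffOp.diffOp K S) ≌ ModuleCat.{v} (ToricDiffOp.diffOp K S)ᵐᵒᵖ,
      Nonempty (E.functor ⋙ ModuleCat.restrictScalars
          (algebraMap K (ToricDiffOp.diffOp K S)ᵐᵒᵖ) ≅
        ModuleCat.restrictScalars (algebraMap K (ToricDiffOp.diffOp K S)))) ∧
    Nonempty (Submodule (ToricDiffOp.diffOp K S) (ToricDiffOp.diffOp K S) ≃o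
      Submodule (ToricDiffOp.diffOp K S)ᵐᵒᵖ (ToricDiffOp.diffOp K S)) := by
  obtain ⟨φ⟩ := ToricDiffOp.exists_algEquiv_op hA hS hSNA hβ ha
  exact ⟨ToricDiffOp.diffOp_translate a S, ToricDiffOp.exists_moduleCat_equivalence φ,
    ⟨ToricDiffOp.idealOrderIso (R := ToricDiffOp.diffOp K S) φ.toRingEquiv⟩⟩
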